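/- All graphs are finite and simple, and a class of graphs is closed under isomorphism. A vertex $y$ of a graph $G$ is a \emph{function} of vertices $x_1,\dots,x_k$ of $G$, all different from $y$, if there is a Boolean function $f$ of $k$ variables such that $A(y,z)=f(A(x_1,z),\dots,A(x_k,z))$ for every vertex $z\notin\{y,x_1,\dots,x_k\}$, where $A$ is the adjacency matrix of $G$. The \emph{functionality} of $y$ in $G$, $\mathrm{fun}_G(y)$, is the minimum $k\ge 0$ such that $y$ is a function of $k$ vertices of $G$, and the \emph{functionality} of $G$ is $\mathrm{fun}(G)=\max_H\min_{y\in V(H)}\mathrm{fun}_H(y)$, where the maximum is over all induced subgraphs $H$ of $G$ with at least one vertex. A class $X$ of graphs has \emph{bounded functionality} if there is a constant $c$ with $\mathrm{fun}(G)\le c$ for all $G\in X$ having at least one vertex. A class is \emph{monotone} if it is closed under deleting vertices and deleting edges. A monotone class $X$ is \emph{finitely defined} if, up to isomorphism, there are only finitely many minimal forbidden induced subgraphs for $X$, that is, graphs that are not in $X$ but all of whose proper induced subgraphs are in $X$. \textbf{Theorem.} Let $X$ be a finitely defined monotone class of graphs. Then $X$ has bounded functionality if and only if $X$ does not contain all forests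 (that is, some graph without cycles is not in $X$). -/

import Mathlib

namespace GraphFunctionality

/-- The vertex `y` of `G` is a function of the vertices `x 0, …, x (k-1)`, all different from `y`:
some Boolean function `f` of `k` variables satisfies
`A(y,z) = f (A(x 0,z), …, A(x (k-1),z))` for every vertex `z` other than `y` and the `x i`,
where `A` is the adjacency matrix of `G`. -/
def IsFunctionOf {V : Type} (G : SimpleGraph V) (y : V) {k : ℕ} (x : Fin k → V) : Prop :=
  open scoped Classical in
  (∀ i, x i ≠ y) ∧
    ∃ f : (Fin k → Bool) → Bool, ∀ z : V, z ≠ y → (∀ i, z ≠ x i) →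
      decide (G.Adj y z) = f (fun i => decide (G.Adj (x i) z))

/-- The functionality of a vertex `y`: the minimum `k` such that `y` is a function of `k` vertices.
The value lies in `ℕ∞` so that the infimum has no default value; in a finite graph it is a natural
number, since `y` is a function of all the other vertices. -/
noncomputable def vertexFun {V : Type} (G : SimpleGraph V) (y : V) : ℕ∞ :=
  ⨅ (k : ℕ) (_ : ∃ x : Fin k → V, IsFunctionOf G y x), (k : ℕ∞)

/-- The functionality of a graph: the maximum, over all induced subgraphs `H` with at least one
vertex, of the minimum over the vertices `y` of `H` of the functionality of `y` in `H`. -/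
noncomputable def graphFun {V : Type} (G : SimpleGraph V) : ℕ∞ :=
  ⨆ (s : Set V) (_ : s.Nonempty), ⨅ y : s, vertexFun (G.induce s) y

/-- A class of finite simple graphs: a property of finite graphs that is invariant under
isomorphism. -/
structure GraphClass where
  /-- `X.Mem G` says that the finite graph `G` belongs to the class `X`. -/
  Mem : ∀ {V : Type} [Finite V], SimpleGraph V → Prop
  mem_of_iso : ∀ {V W : Type} [Finite V] [Finite W] {G : SimpleGraph V} {H : SimpleGraph W},
    Nonempty (G ≃g H) → Mem G → Mem H

namespace GraphClass

/-- A class is monotone if it is closed under vertex deletions and edge deletions. -/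
def IsMonotone (X : GraphClass) : Prop :=
  (∀ {V : Type} [Finite V] (G : SimpleGraph V) (s : Set V), X.Mem G → X.Mem (G.induce s)) ∧
    ∀ {V : Type} [Finite V] (G H : SimpleGraph V), H ≤ G → X.Mem G → X.Mem H

/-- `G` is a minimal forbidden induced subgraph for `X`: it does not belong to `X`, but all of its
proper induced subgraphs do. -/
def IsMinimalForbidden (X : GraphClass) {V : Type} [Finite V] (G : SimpleGraph V) : Prop :=
  ¬ X.Mem G ∧ ∀ s : Set V, s ≠ Set.univ → X.Mem (G.induce s)

/-- A (hereditary) class is finitely defined if it has, up to isomorphism, only finitely many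
minimal forbidden induced subgraphs. Every finite graph is isomorphic to one on some `Fin n`, and
there are only finitely many graphs on each `Fin n`, so it is the same to ask that there are only
finitely many minimal forbidden induced subgraphs with a vertex set of the form `Fin n`. -/
def IsFinitelyDefined (X : GraphClass) : Prop :=
  {p : (n : ℕ) × SimpleGraph (Fin n) | X.IsMinimalForbidden p.2}.Finite

/-- The functionality of the graphs in `X` is bounded by a constant. -/
def HasBoundedFunctionality (X : GraphClass) : Prop :=
  ∃ c : ℕ, ∀ {V : Type} [Finite V] (G : SimpleGraph V), X.Mem G → graphFun G ≤ (c : ℕ∞)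

/-- `X` contains all finite forests. -/
def ContainsAllForests (X : GraphClass) : Prop :=
  ∀ {V : Type} [Finite V] (F : SimpleGraph V), F.IsAcyclic → X.Mem F

end GraphClass

end GraphFunctionality

/-! ### Forests in graphs of large minimum degree. -/

namespace SimpleGraph

/-! If a forest on `n` vertices is missing from a monotone class, every nonempty induced subgraph of
a member has a vertex of degree below `n`: otherwise the forest embeds greedily
(`IsAcyclic.exists_injective_hom`). Functionality is at most degree.

Conversely, let the class contain all forests, with minimal forbidden graphs on at most `N`
vertices. Each of these has a cycle of length at most `N`, so every graph of girth above `N` is a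
member. Among such graphs, those with no cycle of length at most 4, large degree and many components
have large functionality (`not_isFunctionOf`). They arise by iterating `parityCover`, which doubles
girth and preserves the other two properties. -/

theorem IsAcyclic.exists_subsingleton_neighborSet {V : Type*} [Finite V] [Nonempty V]
    {F : SimpleGraph V} (hF : F.IsAcyclic) : ∃ v, (F.neighborSet v).Subsingleton := by
  -- At an end of a longest path every neighbour is on the path, so acyclicity makes it the second
  -- vertex.
  obtain ⟨u, v, p, hp, hmax⟩ := Walk.exists_isPath_forall_isPath_length_le_length F
  have hsupp : ∀ w, F.Adj u w → w ∈ p.support := by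
    intro w hw
    by_contra hn
    have := hmax _ _ (.cons hw.symm p) (hp.cons hn)
    simp at this
  refine ⟨u, fun w hw w' hw' => ?_⟩
  rw [hF.eq_snd_of_adj_start hp hw (hsupp w hw), hF.eq_snd_of_adj_start hp hw' (hsupp w' hw')]

theorem IsAcyclic.exists_injective_hom {W : Type*} [Finite W] [Nonempty W] {H : SimpleGraph W} :
    ∀ (n : ℕ) {V : Type*} [Finite V] {F : SimpleGraph V}, Nat.card V = n → F.IsAcyclic →
      (∀ w, n ≤ (H.neighborSet w).ncard) →
      ∃ f : V → W, f.Injective ∧ ∀ u v, F.Adj u v → H.Adj (f u) (f v) := by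
  intro n
  induction n with
  | zero =>
    intro V _ F hV _ _
    have : IsEmpty V := by simpa [Nat.card_eq_zero, not_infinite_iff_finite.2 ‹_›] using hV
    exact ⟨isEmptyElim, fun a => isEmptyElim a, fun a => isEmptyElim a⟩
  | succ n ih =>
    intro V _ F hV hF hdeg
    classical
    have : Nonempty V := (Nat.card_pos_iff.1 (by lia)).1
    obtain ⟨v, hv⟩ := hF.exists_subsingleton_neighborSet
    have hcard : Nat.card ({v}ᶜ : Set V) = n := by
      have h := Set.ncard_add_ncard_compl ({v} : Set V)
      rw [Set.ncard_singleton, hV] at h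
      rw [Nat.card_coe_set_eq]
      lia
    obtain ⟨g, hg, hadj⟩ := ih hcard (hF.induce {v}ᶜ) fun w => (Nat.le_succ n).trans (hdeg w)
    have hrange : (Set.range g).ncard = n := by
      rw [← Set.image_univ, Set.ncard_image_of_injective _ hg, Set.ncard_univ, hcard]
    have hnew : ∃ w, w ∉ Set.range g ∧
        ∀ u (hu : u ∈ ({v}ᶜ : Set V)), F.Adj v u → H.Adj w (g ⟨u, hu⟩) := by
      -- `w₀` is the image of the only neighbour of `v`. It has at least `n + 1` neighbours, and
      -- only `n` vertices are in use.
      obtain ⟨w₀, hw₀⟩ : ∃ w₀, ∀ u (hu : u ∈ ({v}ᶜ : Set V)), F.Adj v u → g ⟨u, hu⟩ = w₀ := by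
        by_cases h : ∃ u, F.Adj v u
        · obtain ⟨u, hu⟩ := h
          refine ⟨g ⟨u, hu.ne'⟩, fun u' hu' h' => ?_⟩
          congr
          exact hv h' hu
        · exact ⟨Classical.arbitrary W, fun u _ hu => (h ⟨u, hu⟩).elim⟩
      obtain ⟨w, hw, hwg⟩ := Set.exists_mem_notMem_of_ncard_lt_ncard
        (s := Set.range g) (t := H.neighborSet w₀) (by have := hdeg w₀; lia)
      refine ⟨w, hwg, fun u hu hvu => ?_⟩
      rw [hw₀ u hu hvu]
      exact hw.symm
    obtain ⟨w, hwg, hw⟩ := hnew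
    refine ⟨fun u => if hu : u = v then w else g ⟨u, hu⟩, fun a b hab => ?_, fun a b hab => ?_⟩
    · by_cases ha : a = v <;> by_cases hb : b = v <;> simp only [ha, hb, dite_true, dite_false] at hab ⊢
      · exact (hwg ⟨_, hab.symm⟩).elim
      · exact (hwg ⟨_, hab⟩).elim
      · exact congrArg Subtype.val (hg hab)
    · by_cases ha : a = v
      · subst ha
        simpa [hab.ne'] using hw b hab.ne' hab
      · by_cases hb : b = v
        · subst hb
          simpa [ha] using (hw a ha hab.symm).symm
        · simpa [ha, hb] using hadj ⟨a, ha⟩ ⟨b, hb⟩ hab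

/-! ### Graphs of large girth and degree with many components. -/

/-- The cover of `G` whose fibres are the subsets of `Sym2 V`: an edge `e` of `G` lifts to edges
that flip the coordinate `e`. -/
noncomputable def parityCover {V : Type*} (G : SimpleGraph V) :
    SimpleGraph (V × (Sym2 V → ZMod 2)) where
  Adj a b := open scoped Classical in
    G.Adj a.1 b.1 ∧ b.2 = a.2 + Pi.single s(a.1, b.1) 1
  symm := ⟨by
    rintro a b ⟨h, h'⟩
    refine ⟨h.symm, ?_⟩
    rw [h', Sym2.eq_swap, add_assoc]
    funext e
    simp [CharTwo.add_self_eq_zero]⟩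
  loopless := ⟨fun a h => G.irrefl h.1⟩

namespace parityCover

variable {V : Type*} {G : SimpleGraph V}

/-- The covering map. -/
noncomputable def proj (G : SimpleGraph V) : G.parityCover →g G where
  toFun := Prod.fst
  map_rel' h := h.1

theorem eq_of_adj_of_proj_eq {a b c : V × (Sym2 V → ZMod 2)} (hb : G.parityCover.Adj a b)
    (hc : G.parityCover.Adj a c) (h : b.1 = c.1) : b = c :=
  Prod.ext h (by rw [hb.2, hc.2, h])

/-- Consequently the projection of a closed walk crosses every edge an even number of times. -/
theorem coord_eq_add_count [DecidableEq V] {a b : V × (Sym2 V → ZMod 2)}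
    (p : G.parityCover.Walk a b) (e : Sym2 V) :
    b.2 e = a.2 e + ((p.map (proj G)).edges.count e : ZMod 2) := by
  induction p with
  | nil => simp
  | @cons a b c h p ih =>
    rw [ih, Walk.map_cons, Walk.edges_cons, List.count_cons, h.2, Pi.add_apply]
    by_cases he : s(a.1, b.1) = e
    · subst he
      simp only [proj, RelHom.coeFn_mk, Pi.single_eq_same, beq_self_eq_true, if_true, Nat.cast_add,
        Nat.cast_one]
      ring
    · have he' : ¬ e = s(a.1, b.1) := fun h => he h.symm
      simp [proj, he, he']

/-- Neighbours of a vertex with equal projection coincide, so backtracking in the base comes from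
backtracking in the cover. -/
theorem isChain_edges_map_proj {a b : V × (Sym2 V → ZMod 2)} (p : G.parityCover.Walk a b)
    (hp : p.edges.IsChain (· ≠ ·)) : (p.map (proj G)).edges.IsChain (· ≠ ·) := by
  induction p with
  | nil => simp
  | @cons a b c h p ih =>
    cases p with
    | nil => simp
    | @cons _ d _ h' p =>
      simp only [Walk.map_cons, Walk.edges_cons, List.isChain_cons_cons] at hp ih ⊢
      refine ⟨fun he => hp.1 ?_, ih hp.2⟩
      have : a.1 = d.1 := by
        rw [Sym2.eq_swap (a := proj G a), Sym2.congr_right] at he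
        exact he
      rw [eq_of_adj_of_proj_eq h.symm h' this, Sym2.eq_swap]

/-- Passing to the parity cover at least doubles the girth. -/
theorem two_mul_le_length {n : ℕ} (hG : ∀ (v : V) (c : G.Walk v v), c.IsCycle → n ≤ c.length)
    (a : V × (Sym2 V → ZMod 2)) (c : G.parityCover.Walk a a) (hc : c.IsCycle) :
    2 * n ≤ c.length := by
  classical
  set p := c.map (proj G) with hp
  set H : SimpleGraph V := fromEdgeSet {e | e ∈ p.edges} with hH
  have hpH : ∀ e ∈ p.edges, e ∈ H.edgeSet := by
    intro e he
    rw [hH, edgeSet_fromEdgeSet]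
    exact ⟨he, G.not_isDiag_of_mem_edgeSet (p.edges_subset_edgeSet he)⟩
  -- In a forest a non-backtracking walk is a path, and a closed path has length 0.
  have hnot : ¬ H.IsAcyclic := by
    intro hac
    have h1 : (p.transfer H hpH).IsPath := by
      rw [hac.isPath_iff_isChain, Walk.edges_transfer]
      exact isChain_edges_map_proj c hc.isTrail.edges_nodup.isChain
    have h2 := Walk.length_eq_zero_iff.2 (Walk.isPath_iff_nil.1 h1)
    have h3 := hc.three_le_length
    simp only [Walk.length_transfer, hp, Walk.length_map] at h2
    lia
  simp only [IsAcyclic, not_forall, not_not] at hnot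
  obtain ⟨v, q, hq⟩ := hnot
  have hqp : ∀ e ∈ q.edges, e ∈ p.edges := by
    intro e he
    have := q.edges_subset_edgeSet he
    rw [hH, edgeSet_fromEdgeSet] at this
    exact this.1
  have hqG : ∀ e ∈ q.edges, e ∈ G.edgeSet := fun e he => p.edges_subset_edgeSet (hqp e he)
  have hn := hG v _ (hq.transfer hqG)
  rw [Walk.length_transfer] at hn
  -- Each edge of the cycle `q` occurs in `p` a positive even number of times, hence at least twice.
  have hsub : (q.edges ++ q.edges).Subperm p.edges := by
    refine List.subperm_ext_iff.2 fun e he => ?_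
    have he : e ∈ q.edges := by simpa using he
    rw [List.count_append, List.count_eq_one_of_mem hq.isTrail.edges_nodup he]
    have hpos : 0 < p.edges.count e := List.count_pos_iff.2 (hqp e he)
    have hz : ((p.edges.count e : ℕ) : ZMod 2) = 0 := by
      have := coord_eq_add_count c e
      rwa [left_eq_add] at this
    rw [ZMod.natCast_eq_zero_iff] at hz
    exact Nat.le_of_dvd hpos hz
  have := hsub.length_le
  rw [List.length_append, Walk.length_edges, Walk.length_edges, hp, Walk.length_map] at this
  lia

theorem ncard_neighborSet_le [Finite V] (a : V × (Sym2 V → ZMod 2)) :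
    (G.neighborSet a.1).ncard ≤ (G.parityCover.neighborSet a).ncard := by
  classical
  refine Set.ncard_le_ncard_of_injOn (fun v => (v, a.2 + Pi.single s(a.1, v) 1))
    (fun v hv => ⟨hv, rfl⟩) (fun v _ w _ h => congrArg Prod.fst h)

end parityCover

/-- There are finite graphs of large girth and minimum degree with many connected components. -/
theorem exists_girth_degree_components (m d n : ℕ) :
    ∃ (V : Type) (_ : Finite V) (G : SimpleGraph V) (comp : V → Fin m), comp.Surjective ∧
      (∀ u v, G.Adj u v → comp u = comp v) ∧ (∀ v, d ≤ (G.neighborSet v).ncard) ∧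
      ∀ (v : V) (c : G.Walk v v), c.IsCycle → n < c.length := by
  induction n with
  | zero =>
    -- The start is `m` disjoint copies of the complete graph on `d + 1` vertices.
    refine ⟨Fin m × Fin (d + 1), inferInstance, SimpleGraph.fromRel fun a b => a.1 = b.1,
      Prod.fst, Prod.fst_surjective, ?_, ?_, ?_⟩
    · rintro u v ⟨-, h | h⟩
      exacts [h, h.symm]
    · rintro ⟨i, j⟩
      have : (({j}ᶜ : Set (Fin (d + 1)))).ncard = d := by
        have h := Set.ncard_add_ncard_compl ({j} : Set (Fin (d + 1)))
        rw [Set.ncard_singleton, Nat.card_eq_fintype_card, Fintype.card_fin] at h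
        lia
      refine this.symm.le.trans ?_
      refine Set.ncard_le_ncard_of_injOn (fun k => (i, k)) (fun k hk => ?_)
        fun k _ l _ h => congrArg Prod.snd h
      refine ⟨fun h => hk (congrArg Prod.snd h).symm, Or.inl rfl⟩
    · intro v c hc
      have := hc.three_le_length
      lia
  | succ n ih =>
    obtain ⟨V, _, G, comp, hsurj, hcomp, hdeg, hG⟩ := ih
    refine ⟨V × (Sym2 V → ZMod 2), inferInstance, G.parityCover, comp ∘ Prod.fst,
      hsurj.comp Prod.fst_surjective, fun u v h => hcomp _ _ h.1,
      fun v => (hdeg v.1).trans (parityCover.ncard_neighborSet_le v), fun v c hc => ?_⟩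
    have := parityCover.two_mul_le_length (n := n + 1) hG v c hc
    have := hc.three_le_length
    lia

theorem eq_of_common_neighbors {V : Type*} {G : SimpleGraph V}
    (hG : ∀ (v : V) (c : G.Walk v v), c.IsCycle → 4 < c.length) {x y a b : V} (hxy : x ≠ y)
    (hxa : G.Adj x a) (hya : G.Adj y a) (hxb : G.Adj x b) (hyb : G.Adj y b) : a = b := by
  by_contra hab
  have := hG x (.cons hxa (.cons hya.symm (.cons hyb (.cons hxb.symm .nil)))) (by
    rw [Walk.cons_isCycle_iff]
    simp [hxy, hxy.symm, hab, hxa.ne, hxa.ne', hya.ne', hxb.ne, hxb.ne', hyb.ne])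
  simp at this

end SimpleGraph

namespace GraphFunctionality

/-! ### Bounds on the functionality of a vertex. -/

theorem IsFunctionOf.vertexFun_le {V : Type} {G : SimpleGraph V} {y : V} {k : ℕ} {x : Fin k → V}
    (h : IsFunctionOf G y x) : vertexFun G y ≤ k :=
  iInf₂_le k ⟨x, h⟩

theorem vertexFun_le_ncard_neighborSet {V : Type} [Finite V] (G : SimpleGraph V) (y : V) :
    vertexFun G y ≤ (G.neighborSet y).ncard := by
  let e := Finite.equivFin (G.neighborSet y)
  refine IsFunctionOf.vertexFun_le (x := fun i => (e.symm i : V))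
    ⟨fun i => (e.symm i).2.ne', fun _ => false, fun z _ hz => ?_⟩
  rw [decide_eq_false_iff_not]
  intro h
  exact hz (e ⟨z, h⟩) (congrArg Subtype.val (e.symm_apply_apply ⟨z, h⟩)).symm

theorem IsFunctionOf.of_iso {V W : Type} {G : SimpleGraph V} {H : SimpleGraph W} (e : G ≃g H)
    {y : V} {k : ℕ} {x : Fin k → V} (h : IsFunctionOf G y x) :
    IsFunctionOf H (e y) (e ∘ x) := by
  classical
  obtain ⟨hx, f, hf⟩ := h
  refine ⟨fun i hi => hx i (e.injective hi), f, fun z hz hzx => ?_⟩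
  obtain ⟨z, rfl⟩ := e.surjective z
  have key : ∀ a b, decide (H.Adj (e a) (e b)) = decide (G.Adj a b) := fun a b =>
    decide_eq_decide.2 e.map_adj_iff
  simp only [Function.comp_apply, key]
  exact hf z (fun h => hz (h ▸ rfl)) fun i h => hzx i (h ▸ rfl)

/-- Two vertices nonadjacent to all `x i`, one adjacent to `y` and one not, would force two values
of `f` at the all-false vector. -/
theorem not_isFunctionOf {V : Type} [Finite V] {G : SimpleGraph V} {k m : ℕ} {comp : V → Fin m}
    (hsurj : comp.Surjective) (hcomp : ∀ u v, G.Adj u v → comp u = comp v)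
    (hdeg : ∀ v, 2 * k < (G.neighborSet v).ncard) (hm : k + 1 < m)
    (hG : ∀ (v : V) (c : G.Walk v v), c.IsCycle → 4 < c.length) (y : V) (x : Fin k → V) :
    ¬ IsFunctionOf G y x := by
  classical
  rintro ⟨hx, f, hf⟩
  obtain ⟨z, hyz, hzx, hz⟩ : ∃ z, G.Adj y z ∧ (∀ i, z ≠ x i) ∧ ∀ i, ¬ G.Adj (x i) z := by
    -- The neighbours of `y` to avoid: each `x i`, and its at most one common neighbour with `y`.
    -- The default `y` is harmless, as only the bound `2 * k` matters.
    let g : Fin k ⊕ Fin k → V := Sum.elim x fun i =>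
      if h : ∃ z, G.Adj y z ∧ G.Adj (x i) z then h.choose else y
    have hcard : (Set.range g).ncard ≤ 2 * k := by
      refine (Finite.card_range_le g).trans ?_
      simp [two_mul]
    obtain ⟨z, hz, hzg⟩ := Set.exists_mem_notMem_of_ncard_lt_ncard (hcard.trans_lt (hdeg y))
    refine ⟨z, hz, fun i h => hzg ⟨.inl i, h.symm⟩, fun i h => hzg ⟨.inr i, ?_⟩⟩
    have hex : ∃ z, G.Adj y z ∧ G.Adj (x i) z := ⟨z, hz, h⟩
    simp only [g, Sum.elim_inr, dif_pos hex]
    exact SimpleGraph.eq_of_common_neighbors hG (hx i).symm hex.choose_spec.1 hex.choose_spec.2 hz h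
  obtain ⟨w, hwy, hwx⟩ : ∃ w, comp w ≠ comp y ∧ ∀ i, comp w ≠ comp (x i) := by
    let g : Option (Fin k) → Fin m := fun o => o.elim (comp y) fun i => comp (x i)
    have hg : ¬ g.Surjective := by
      intro h
      have := Fintype.card_le_of_surjective g h
      simp at this
      lia
    simp only [Function.Surjective, not_forall, not_exists] at hg
    obtain ⟨j, hj⟩ := hg
    obtain ⟨w, rfl⟩ := hsurj j
    exact ⟨w, Ne.symm (hj none), fun i => Ne.symm (hj (some i))⟩
  have h1 := hf z hyz.ne' hzx
  have h2 := hf w (fun h => hwy (h ▸ rfl)) fun i h => hwx i (h ▸ rfl)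
  have hwy' : ¬ G.Adj y w := fun h => hwy (hcomp _ _ h).symm
  have hwx' : ∀ i, ¬ G.Adj (x i) w := fun i h => hwx i (hcomp _ _ h).symm
  simp only [hyz, hz, hwy', hwx', decide_true, decide_false] at h1 h2
  exact absurd (h1.trans h2.symm) (by decide)

/-! ### Forbidden subgraphs and the two directions. -/

namespace GraphClass

/-- A graph outside a class contains a minimal forbidden induced subgraph. -/
theorem exists_isMinimalForbidden {X : GraphClass} {V : Type} [Finite V]
    {G : SimpleGraph V} (hG : ¬ X.Mem G) :
    ∃ s : Set V, X.IsMinimalForbidden (G.induce s) := by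
  have huniv : ¬ X.Mem (G.induce Set.univ) :=
    fun h => hG (X.mem_of_iso ⟨G.induceUnivIso⟩ h)
  obtain ⟨s, hs⟩ := (Set.toFinite {s : Set V | ¬ X.Mem (G.induce s)}).exists_minimal ⟨_, huniv⟩
  refine ⟨s, hs.prop, fun t ht => ?_⟩
  by_contra hmem
  have hsub : Subtype.val '' t ⊆ s := by
    rintro _ ⟨a, -, rfl⟩
    exact a.2
  have hmem' : ¬ X.Mem (G.induce (Subtype.val '' t)) := by
    intro h
    refine hmem (X.mem_of_iso ⟨SimpleGraph.Iso.symm ?_⟩ h)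
    exact
      { toEquiv := Equiv.Set.image _ t Subtype.val_injective
        map_rel_iff' := Iff.rfl }
  refine ht (Set.eq_univ_of_forall fun a => ?_)
  obtain ⟨b, hb, hba⟩ := hs.le_of_le hmem' hsub a.2
  exact Subtype.val_injective hba ▸ hb

theorem IsMinimalForbidden.of_iso {X : GraphClass} {V W : Type} [Finite V] [Finite W]
    {G : SimpleGraph V} {H : SimpleGraph W} (e : G ≃g H) (h : X.IsMinimalForbidden G) :
    X.IsMinimalForbidden H := by
  refine ⟨fun hH => h.1 (X.mem_of_iso ⟨e.symm⟩ hH), fun s hs => ?_⟩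
  have hs' : e ⁻¹' s ≠ Set.univ := by
    intro h
    refine hs (Set.eq_univ_of_forall fun w => ?_)
    have : e.symm w ∈ e ⁻¹' s := h ▸ Set.mem_univ _
    simpa using this
  refine X.mem_of_iso ⟨?_⟩ (h.2 _ hs')
  exact
    { toEquiv := e.toEquiv.subtypeEquiv fun a => Iff.rfl
      map_rel_iff' := by
        rintro ⟨a, ha⟩ ⟨b, hb⟩
        exact e.map_adj_iff }

theorem IsFinitelyDefined.exists_card_le {X : GraphClass} (hfin : X.IsFinitelyDefined) :
    ∃ N : ℕ, ∀ {V : Type} [Finite V] (G : SimpleGraph V),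
      X.IsMinimalForbidden G → Nat.card V ≤ N := by
  obtain ⟨N, hN⟩ := (hfin.image Sigma.fst).bddAbove
  refine ⟨N, fun {V} _ G hG => hN ⟨⟨Nat.card V, G.map (Finite.equivFin V).toEmbedding⟩, ?_, rfl⟩⟩
  exact hG.of_iso (SimpleGraph.Iso.map (Finite.equivFin V) G)

theorem ContainsAllForests.mem_of_forall_lt_length {X : GraphClass} (hX : X.ContainsAllForests)
    {N : ℕ} (hN : ∀ {V : Type} [Finite V] (G : SimpleGraph V),
      X.IsMinimalForbidden G → Nat.card V ≤ N)
    {V : Type} [Finite V] {G : SimpleGraph V}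
    (hG : ∀ (v : V) (c : G.Walk v v), c.IsCycle → N < c.length) : X.Mem G := by
  by_contra hmem
  obtain ⟨s, hs⟩ := exists_isMinimalForbidden hmem
  refine hs.1 (hX _ fun v c hc => ?_)
  have := Fintype.ofFinite s
  have h1 := hG _ _ (hc.map (f := (SimpleGraph.Embedding.induce s).toHom) Subtype.val_injective)
  have h2 := hN _ hs
  have h3 := List.Nodup.length_le_card hc.support_nodup
  rw [SimpleGraph.Walk.length_map] at h1
  rw [List.length_tail, SimpleGraph.Walk.length_support, ← Nat.card_eq_fintype_card] at h3
  lia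

theorem ContainsAllForests.not_hasBoundedFunctionality {X : GraphClass}
    (hX : X.ContainsAllForests) (hfin : X.IsFinitelyDefined) : ¬ X.HasBoundedFunctionality := by
  rintro ⟨c, hc⟩
  obtain ⟨N, hN⟩ := hfin.exists_card_le
  obtain ⟨V, _, G, comp, hsurj, hcomp, hdeg, hG⟩ :=
    -- For `k ≤ c`, the vertex `y` and the `x i` meet at most `c + 1` components, and degree `2 * c
    -- + 1` exceeds `2 * k`.
    SimpleGraph.exists_girth_degree_components (c + 2) (2 * c + 1) (max N 4)
  have hmem : X.Mem G := hX.mem_of_forall_lt_length hN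
    fun v p hp => (le_max_left _ _).trans_lt (hG v p hp)
  have hne : Nonempty V := ⟨(hsurj 0).choose⟩
  have hlow : ((c + 1 : ℕ) : ℕ∞) ≤ graphFun G := by
    refine le_trans ?_ (le_iSup₂ (f := fun (s : Set V) (_ : s.Nonempty) =>
      ⨅ y : s, vertexFun (G.induce s) y) Set.univ Set.univ_nonempty)
    refine le_iInf fun y => le_iInf₂ fun k ⟨x, hx⟩ => ?_
    by_contra hlt
    have hk : k ≤ c := by
      rw [Nat.cast_le] at hlt
      lia
    exact not_isFunctionOf hsurj hcomp (fun v => by have := hdeg v; lia) (by lia)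
      (fun v p hp => (le_max_right _ _).trans_lt (hG v p hp)) _ _ (hx.of_iso G.induceUnivIso)
  have := hlow.trans (hc G hmem)
  rw [Nat.cast_le] at this
  lia

theorem IsMonotone.mem_of_injective {X : GraphClass} (hX : X.IsMonotone) {V W : Type} [Finite V]
    [Finite W] {F : SimpleGraph V} {H : SimpleGraph W} {f : V → W} (hf : f.Injective)
    (hadj : ∀ u v, F.Adj u v → H.Adj (f u) (f v)) (hH : X.Mem H) : X.Mem F := by
  refine hX.2 (H.comap f) F (fun u v h => hadj u v h) ?_
  exact X.mem_of_iso ⟨(SimpleGraph.Embedding.comap ⟨f, hf⟩ H).isoInduceRange.symm⟩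
    (hX.1 H _ hH)

theorem IsMonotone.hasBoundedFunctionality {X : GraphClass} (hX : X.IsMonotone)
    (hF : ¬ X.ContainsAllForests) : X.HasBoundedFunctionality := by
  simp only [ContainsAllForests, not_forall] at hF
  obtain ⟨V, _, F, hF, hnot⟩ := hF
  refine ⟨Nat.card V, fun {W} _ G hG => iSup₂_le fun s hs => ?_⟩
  have : Nonempty s := hs.to_subtype
  obtain ⟨y, hy⟩ : ∃ y, ((G.induce s).neighborSet y).ncard < Nat.card V := by
    by_contra! h
    obtain ⟨f, hf, hadj⟩ := SimpleGraph.IsAcyclic.exists_injective_hom _ rfl hF h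
    exact hnot (hX.mem_of_injective hf hadj (hX.1 G s hG))
  exact (iInf_le _ y).trans ((vertexFun_le_ncard_neighborSet _ y).trans (by exact_mod_cast hy.le))

end GraphClass

end GraphFunctionality

theorem theorem10 (X : GraphFunctionality.GraphClass) (hmono : X.IsMonotone)
    (hfin : X.IsFinitelyDefined) :
    X.HasBoundedFunctionality ↔ ¬ X.ContainsAllForests :=
  ⟨fun hb hX => hX.not_hasBoundedFunctionality hfin hb, hmono.hasBoundedFunctionality⟩
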